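/- All groups are abelian, written additively. For a group $G$ let $\mathrm{Tor}(G)$ be its torsion subgroup and, for a prime $p$, let $\mathrm{Tor}_p(G)=\{x\in G : p^k x=0 \text{ for some } k\geq 0\}$. $G$ is reduced if $\{0\}$ is its only divisible subgroup. A subgroup $H\le G$ is pure if for every $n$, every element of $H$ that is divisible by $n$ in $G$ is divisible by $n$ in $H$. Let $\lambda$ be a cardinal with $\lambda^{\aleph_0}>\lambda>2^{\aleph_0}$, and let $G$ be a reduced abelian group of cardinality $\lambda$ with $|G/\mathrm{Tor}(G)|^{\aleph_0}=\lambda^{\aleph_0}$. Let $\mathbb A$ be a set of primes such that (a) for each $p\in\mathbb A$, $G$ has a pure subgroup $K_p=\bigoplus_{n<\omega}K_{(p,n)}$ (internal direct sum), where each $K_{(p,n)}\neq\{0\}$ is a finite $p$-group; (b) for each prime $p\notin\mathbb A$, $G/\mathrm{Tor}_p(G)$ is $p$-divisible and $|\mathrm{Tor}_p(G)|\le 2^{\aleph_0}$. Then, for any such choice of the $K_p$ and with $K=\bigoplus_{p\in\mathbb A}K_p$, there are at least $\lambda^{\aleph_0}$ homomorphisms from $G$ to $K$, i.e. $|\mathrm{Hom}(G,K)|\ge\lambda^{\aleph_0}$.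 -/

import Mathlib

open scoped Cardinal DirectSum

universe u

/-- An abelian group `G` is `n`-divisible if every element is an `n`-th multiple in `G`. -/
def IsNatDivisible (G : Type*) [AddCommGroup G] (n : ℕ) : Prop :=
  ∀ x : G, ∃ y : G, n • y = x

/-- An abelian group is reduced if its only divisible subgroup is the trivial one. -/
def IsReducedAbelian (G : Type*) [AddCommGroup G] : Prop :=
  ∀ D : AddSubgroup G, (∀ n : ℕ, n ≠ 0 → IsNatDivisible D n) → D = ⊥

/-- A subgroup `H` of `G` is pure if every element of `H` that is divisible by `n` in `G`
is divisible by `n` in `H`. -/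
def IsPureSubgroup {G : Type*} [AddCommGroup G] (H : AddSubgroup G) : Prop :=
  ∀ (n : ℕ) (k : G), k ∈ H → (∃ g : G, n • g = k) → ∃ h ∈ H, n • h = k

/-- Every element of the abelian group has order a power of `p`. -/
def IsAbelianPGroup (G : Type*) [AddCommGroup G] (p : ℕ) : Prop :=
  ∀ x : G, ∃ k : ℕ, p ^ k • x = 0

/-!
For each prime `p` fix a basis of `G / pG` over `ℤ / pℤ`, indexed by `ModIndex G p`, and let `μ` be
the supremum of the dimensions over `p ∈ A`. The proof compares `μ` with the size of `G`, and then
builds homomorphisms `G → ⨁ K p` out of the coordinate functionals of these bases, each followed by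
an embedding of `ℤ / pℤ` into `K p`.

*Size.* An element of a reduced group is determined by a sequence of digits, each of them a class
modulo a prime, as long as every prime is used infinitely often
(`IsReducedAbelian.mk_le_power_aleph0`): the differences of two such expansions generate a divisible
subgroup. For `p ∉ A` the divisibility of `G / Tor_p(G)` makes `Tor_p(G) → G / pG` surjective, so
`|G / pG| ≤ 2 ^ ℵ₀`. As `2 ^ ℵ₀ < lam`, it follows that `2 ^ ℵ₀ < μ` and `lam ≤ μ ^ ℵ₀`.

*The supremum is attained.* If `G / pG` has dimension `μ` for some `p ∈ A`, then it has `2 ^ μ`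
functionals, and `lam ^ ℵ₀ ≤ μ ^ ℵ₀ ≤ 2 ^ μ`.

*The supremum is not attained.* Choose primes `P n ∈ A` such that the dimensions of
`G / (P n)G` increase strictly to `μ`. Coding initial segments of sequences gives `μ ^ ℵ₀` functions
`g η`, choosing one basis element modulo each `P n`, any two of which agree at finitely many places
only (`exists_eventually_ne_of_sigma`). An element `x` of `G` has finitely many nonzero coordinates
modulo each `P n`, and at most `2 ^ ℵ₀` of the functions `g η` meet these finite sets infinitely often
(`mk_frequently_mem_le`). So all but `lam · 2 ^ ℵ₀ = lam < lam ^ ℵ₀ ≤ μ ^ ℵ₀` of the functions meet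
them finitely often for every `x`, and for each such function the sum of its coordinate functionals
is a homomorphism into the direct sum
(`mk_sigma_power_aleph0_le_mk_addMonoidHom_directSum`).
-/

/-! ### Bounding the size of a reduced group by its quotients `G / pG` -/

/-- The `d n` generate a divisible subgroup: `d n` is a multiple of `d m = p • d (m + 1)` for some
`m ≥ n` with `q m = p`. -/
theorem IsReducedAbelian.eq_zero_of_eq_nsmul_succ {G : Type*} [AddCommGroup G]
    (hG : IsReducedAbelian G) {q : ℕ → ℕ}
    (hq : ∀ p : ℕ, p.Prime → ∀ n, ∃ m, n ≤ m ∧ q m = p) {d : ℕ → G}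
    (hd : ∀ n, d n = q n • d (n + 1)) (n : ℕ) : d n = 0 := by
  have hmul : ∀ n m, n ≤ m → ∃ k : ℕ, d n = k • d m := by
    intro n m hnm
    induction m, hnm using Nat.le_induction with
    | base => exact ⟨1, by simp⟩
    | succ m _ ih =>
      obtain ⟨k, hk⟩ := ih
      exact ⟨k * q m, by rw [hk, hd m, smul_smul]⟩
  have hprime : ∀ p : ℕ, p.Prime → ∀ x ∈ AddSubgroup.closure (Set.range d),
      ∃ y ∈ AddSubgroup.closure (Set.range d), p • y = x := by
    intro p hp x hx
    induction hx using AddSubgroup.closure_induction with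
    | mem x hx =>
      obtain ⟨n, rfl⟩ := hx
      obtain ⟨m, hnm, rfl⟩ := hq p hp n
      obtain ⟨k, hk⟩ := hmul n m hnm
      refine ⟨k • d (m + 1), nsmul_mem (AddSubgroup.subset_closure (Set.mem_range_self _)) k, ?_⟩
      rw [hk, hd m, smul_comm]
    | zero => exact ⟨0, zero_mem _, smul_zero _⟩
    | add x y _ _ hx hy =>
      obtain ⟨a, ha, rfl⟩ := hx
      obtain ⟨b, hb, rfl⟩ := hy
      exact ⟨a + b, add_mem ha hb, smul_add _ _ _⟩
    | neg x _ hx =>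
      obtain ⟨a, ha, rfl⟩ := hx
      exact ⟨-a, neg_mem ha, smul_neg _ _⟩
  have hbot := hG (AddSubgroup.closure (Set.range d)) fun n hn ↦ by
    induction n using Nat.recOnMul with
    | zero => exact absurd rfl hn
    | one => exact fun x ↦ ⟨x, one_smul _ x⟩
    | prime p hp =>
      intro x
      obtain ⟨y, hy, hyx⟩ := hprime p hp x x.2
      exact ⟨⟨y, hy⟩, Subtype.ext hyx⟩
    | mul a b ha hb =>
      intro x
      obtain ⟨y, rfl⟩ := ha (left_ne_zero_of_mul hn) x
      obtain ⟨z, rfl⟩ := hb (right_ne_zero_of_mul hn) y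
      exact ⟨z, mul_smul a b z⟩
  have hmem : d n ∈ AddSubgroup.closure (Set.range d) := AddSubgroup.subset_closure ⟨n, rfl⟩
  rwa [hbot, AddSubgroup.mem_bot] at hmem

theorem ModN.mkQ_eq_mkQ_iff {G : Type*} [AddCommGroup G] {n : ℕ} {x y : G} :
    ModN.mkQ n x = ModN.mkQ n y ↔ ∃ z : G, n • z = x - y := by
  refine (Submodule.Quotient.eq _).trans ?_
  simp [LinearMap.mem_range]

theorem ModN.mkQ_surjective {G : Type*} [AddCommGroup G] (n : ℕ) :
    Function.Surjective (ModN.mkQ n : G →+ ModN G n) :=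
  Submodule.mkQ_surjective _

/-- Every element of `G` has a sequence of digits: `x = s₀ + q₀ x₁`, `x₁ = s₁ + q₁ x₂`, …, where
`sₙ` represents the class of `xₙ` modulo `qₙ`. If each prime occurs infinitely often among the
`qₙ` and `G` is reduced, then `x` is determined by these classes. -/
theorem IsReducedAbelian.mk_le_power_aleph0 {G : Type u} [AddCommGroup G]
    (hG : IsReducedAbelian G) {κ : Cardinal.{u}}
    (hκ : ∀ p : ℕ, p.Prime → #(ModN G p) ≤ κ) : #G ≤ κ ^ ℵ₀ := by
  let q : ℕ → ℕ := fun n ↦ Nat.nth Nat.Prime n.unpair.1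
  have hq : ∀ p : ℕ, p.Prime → ∀ n, ∃ m, n ≤ m ∧ q m = p := fun p hp n ↦
    ⟨Nat.pair (Nat.count Nat.Prime p) n, Nat.right_le_pair _ _, by simp [q, Nat.nth_count hp]⟩
  have hex : ∀ (p : ℕ) (x : G), ∃ y : G,
      x = Function.surjInv (ModN.mkQ_surjective p) (ModN.mkQ p x) + p • y := by
    intro p x
    obtain ⟨z, hz⟩ := ModN.mkQ_eq_mkQ_iff.1
      (Function.surjInv_eq (ModN.mkQ_surjective p) (ModN.mkQ p x)).symm
    exact ⟨z, by rw [hz]; abel⟩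
  choose next hnext using hex
  let tail : G → ℕ → G := fun x n ↦ Nat.rec x (fun n z ↦ next (q n) z) n
  have hinj : Function.Injective
      (fun (x : G) (n : ℕ) ↦ (ModN.mkQ (q n) (tail x n) : ModN G (q n))) := by
    intro x y hxy
    refine sub_eq_zero.1 (hG.eq_zero_of_eq_nsmul_succ hq (d := fun n ↦ tail x n - tail y n) ?_ 0)
    intro n
    have h1 : tail x n = _ + q n • tail x (n + 1) := hnext (q n) (tail x n)
    have h2 : tail y n = _ + q n • tail y (n + 1) := hnext (q n) (tail y n)
    have h3 : ModN.mkQ (q n) (tail x n) = ModN.mkQ (q n) (tail y n) := congrFun hxy n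
    rw [h3] at h1
    -- The two expansions have the same digit here, so it cancels.
    change tail x n - tail y n = q n • (tail x (n + 1) - tail y (n + 1))
    rw [smul_sub, eq_sub_of_add_eq' h1.symm, eq_sub_of_add_eq' h2.symm, sub_sub_sub_cancel_right]
  calc #G ≤ #(∀ n, ModN G (q n)) := Cardinal.mk_le_of_injective hinj
    _ = Cardinal.prod fun n ↦ #(ModN G (q n)) := Cardinal.mk_pi _
    _ ≤ Cardinal.prod fun _ : ℕ ↦ κ :=
      Cardinal.prod_le_prod _ _ fun n ↦ hκ _ (Nat.prime_nth_prime _)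
    _ = κ ^ ℵ₀ := by simp

/-- Modulo `n` every element is congruent to an element of `H`. -/
theorem mk_modN_le_of_isNatDivisible_quotient {G : Type*} [AddCommGroup G] {n : ℕ}
    {H : AddSubgroup G} (h : IsNatDivisible (G ⧸ H) n) : #(ModN G n) ≤ #H := by
  refine Cardinal.mk_le_of_surjective (f := fun t : H ↦ ModN.mkQ n (t : G)) fun v ↦ ?_
  obtain ⟨x, rfl⟩ := ModN.mkQ_surjective n v
  obtain ⟨y, hy⟩ := h (QuotientAddGroup.mk x)
  obtain ⟨y, rfl⟩ := QuotientAddGroup.mk_surjective y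
  rw [← QuotientAddGroup.mk_nsmul, QuotientAddGroup.eq] at hy
  refine ⟨⟨_, hy⟩, ModN.mkQ_eq_mkQ_iff.2 ⟨-y, ?_⟩⟩
  simp

/-! ### Coordinates modulo a prime -/

/-- The index set of a basis of `G / pG` over `ℤ / pℤ`. -/
abbrev ModIndex (G : Type*) [AddCommGroup G] (p : ℕ) [Fact p.Prime] : Type _ :=
  Module.Basis.ofVectorSpaceIndex (ZMod p) (ModN G p)

/-- The coordinates of the class of an element in a basis of `G / pG` over `ℤ / pℤ`. -/
noncomputable def modCoord (G : Type*) [AddCommGroup G] (p : ℕ) [Fact p.Prime] :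
    G →+ (ModIndex G p →₀ ZMod p) :=
  (Module.Basis.ofVectorSpace (ZMod p) (ModN G p)).repr.toLinearMap.toAddMonoidHom.comp
    (ModN.mkQ p)

theorem modCoord_surjective (G : Type*) [AddCommGroup G] (p : ℕ) [Fact p.Prime] :
    Function.Surjective (modCoord G p) :=
  (Module.Basis.ofVectorSpace (ZMod p) (ModN G p)).repr.surjective.comp (ModN.mkQ_surjective p)

theorem mk_modN_le_max (G : Type u) [AddCommGroup G] (p : ℕ) [Fact p.Prime] :
    #(ModN G p) ≤ max ℵ₀ #(ModIndex G p) := by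
  rw [Cardinal.mk_congr (Module.Basis.ofVectorSpace (ZMod p) (ModN G p)).repr.toEquiv]
  rcases finite_or_infinite (ModIndex G p) with h | h
  · have : Finite (ModIndex G p →₀ ZMod p) := Finite.of_injective _ DFunLike.coe_injective
    exact (Cardinal.lt_aleph0_of_finite _).le.trans (le_max_left _ _)
  · rw [Cardinal.mk_finsupp_lift_of_infinite]
    simp only [Cardinal.lift_id', max_le_iff, le_max_right, true_and]
    exact ((Cardinal.lift_lt_aleph0.2 (Cardinal.lt_aleph0_of_finite (ZMod p))).le).trans
      (le_max_left _ _)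

/-- A nontrivial `p`-group contains a copy of `ℤ / pℤ`. -/
theorem exists_zmod_injective {H : Type*} [AddCommGroup H] [Nontrivial H] {p : ℕ}
    [hp : Fact p.Prime] (hH : IsAbelianPGroup H p) :
    ∃ j : ZMod p →+ H, Function.Injective j := by
  classical
  obtain ⟨x, hx⟩ := exists_ne (0 : H)
  have hex := hH x
  -- The last nonzero multiple `p ^ k • x` of `x` has order `p`.
  have hpos : Nat.find hex ≠ 0 := fun h0 ↦ hx (by simpa [h0] using Nat.find_spec hex)
  obtain ⟨k, hk⟩ := Nat.exists_eq_succ_of_ne_zero hpos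
  have hy : p ^ k • x ≠ 0 := Nat.find_min hex (by omega)
  have hpy : p • (p ^ k • x) = 0 := by
    rw [smul_smul, ← pow_succ']
    simpa [hk] using Nat.find_spec hex
  have hord : addOrderOf (p ^ k • x) = p := addOrderOf_eq_prime hpy hy
  refine ⟨ZMod.lift p ⟨zmultiplesHom H (p ^ k • x), by simpa using hpy⟩, ?_⟩
  rw [ZMod.lift_injective]
  intro m hm
  rw [ZMod.intCast_zmod_eq_zero_iff_dvd]
  have := addOrderOf_dvd_iff_zsmul_eq_zero.2 hm
  rwa [hord] at this

/-- Each set of basis elements of `G / pG` gives a functional with value `1` on the set and `0` on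
the other basis elements; composing with `j` gives pairwise distinct homomorphisms. -/
theorem two_power_le_mk_addMonoidHom (G : Type u) [AddCommGroup G] {H : Type u} [AddCommGroup H]
    (p : ℕ) [Fact p.Prime] {j : ZMod p →+ H} (hj : Function.Injective j) :
    (2 : Cardinal.{u}) ^ #(ModIndex G p) ≤ #(G →+ H) := by
  classical
  rw [← Cardinal.mk_set]
  let F : Set (ModIndex G p) → ((ModIndex G p →₀ ZMod p) →+ ZMod p) := fun S ↦
    Finsupp.liftAddHom fun i ↦ if i ∈ S then AddMonoidHom.id _ else 0
  have hF : ∀ S i, F S (Finsupp.single i 1) = if i ∈ S then 1 else 0 := by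
    intro S i
    by_cases h : i ∈ S <;> simp [F, h]
  refine Cardinal.mk_le_of_injective (f := fun S ↦ j.comp ((F S).comp (modCoord G p))) ?_
  intro S T hST
  ext i
  obtain ⟨x, hx⟩ := modCoord_surjective G p (Finsupp.single i 1)
  have h := hj (DFunLike.congr_fun hST x)
  simp only [AddMonoidHom.comp_apply, hx, hF] at h
  by_cases h1 : i ∈ S <;> by_cases h2 : i ∈ T <;> simp_all

/-! ### Families of eventually different functions -/

/-- The `n`-th value `g η n` records the first `n` terms of `η`, as far as these lie in the first
`n + 1` summands; this is a finite sequence from a set of size at most `#(ι n)`. -/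
theorem exists_eventually_ne_of_sigma {ι : ℕ → Type u} (hι : ∀ n, ℵ₀ ≤ #(ι n))
    (hmono : Monotone fun n ↦ #(ι n)) :
    ∃ g : (ℕ → Σ n, ι n) → ∀ n, ι n,
      Pairwise fun η η' ↦ ∀ᶠ n in Filter.atTop, g η n ≠ g η' n := by
  classical
  have hcard : ∀ n, #{x : Σ n, ι n // x.1 ≤ n} ≤ #(ι n) := by
    intro n
    have hemb : ∀ m, m ≤ n → ∃ f : ι m → ι n, Function.Injective f := fun m hm ↦ by
      obtain ⟨f⟩ := hmono hm
      exact ⟨f, f.injective⟩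
    choose f hf using hemb
    calc #{x : Σ n, ι n // x.1 ≤ n} ≤ #(ULift.{u} ℕ × ι n) := by
          refine Cardinal.mk_le_of_injective (f := fun x ↦ (⟨x.1.1⟩, f x.1.1 x.2 x.1.2)) ?_
          rintro ⟨⟨m, a⟩, hm⟩ ⟨⟨m', b⟩, hm'⟩ h
          obtain ⟨h1, h2⟩ := Prod.mk.inj h
          obtain rfl : m = m' := congrArg ULift.down h1
          exact Subtype.ext (congrArg (Sigma.mk m) (hf m hm h2))
      _ = ℵ₀ * #(ι n) := by simp
      _ = #(ι n) := Cardinal.aleph0_mul_eq (hι n)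
  have hcode : ∀ n, Nonempty ((Fin n → Option {x : Σ n, ι n // x.1 ≤ n}) ↪ ι n) := by
    intro n
    have h1 : #(Option {x : Σ n, ι n // x.1 ≤ n}) ≤ #(ι n) := by
      rw [Cardinal.mk_option]
      exact Cardinal.add_le_of_le (hι n) (hcard n) (Cardinal.one_le_aleph0.trans (hι n))
    have h2 : #(Fin n → Option {x : Σ n, ι n // x.1 ≤ n}) ≤ #(ι n) := by
      rw [Cardinal.mk_pi, Cardinal.prod_const]
      simp only [Cardinal.mk_fin, Cardinal.lift_natCast, Cardinal.lift_id']
      exact (Cardinal.power_le_power_right h1).trans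
        (by exact_mod_cast Cardinal.power_nat_le (hι n))
    exact h2
  let code := fun n ↦ (hcode n).some
  refine ⟨fun η n ↦ code n fun i ↦ if h : (η i).1 ≤ n then some ⟨η i, h⟩ else none, ?_⟩
  intro η η' hne
  obtain ⟨i, hi⟩ := Function.ne_iff.1 hne
  filter_upwards [Filter.eventually_ge_atTop (max (i + 1) (max (η i).1 (η' i).1))] with n hn heq
  have h1 : (η i).1 ≤ n := by omega
  have h2 : (η' i).1 ≤ n := by omega
  have h3 := congrFun ((code n).injective heq) ⟨i, by omega⟩
  simp only [h1, h2, dif_pos, Option.some.injEq, Subtype.mk.injEq] at h3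
  exact hi h3

/-- A member of the family that hits the finite sets `F n` infinitely often is determined by the
set of its hits, which is a subset of the countable set `Σ n, F n`. -/
theorem mk_frequently_mem_le {M : Type u} {ι : ℕ → Type u} {g : M → ∀ n, ι n}
    (hg : Pairwise fun η η' ↦ ∀ᶠ n in Filter.atTop, g η n ≠ g η' n) (F : ∀ n, Finset (ι n)) :
    #{η | ∃ᶠ n in Filter.atTop, g η n ∈ F n} ≤ 2 ^ ℵ₀ := by
  calc #{η | ∃ᶠ n in Filter.atTop, g η n ∈ F n} ≤ #(Set (Σ n, F n)) := by
        refine Cardinal.mk_le_of_injective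
          (f := fun η ↦ {x : Σ n, F n | g η.1 x.1 = x.2}) ?_
        rintro ⟨η, hη⟩ ⟨η', _⟩ h
        refine Subtype.ext ?_
        by_contra hne
        obtain ⟨n, hn, hn'⟩ := (Filter.Frequently.and_eventually hη (hg hne)).exists
        have hmem : (⟨n, g η n, hn⟩ : Σ n, F n) ∈ {x : Σ n, F n | g η x.1 = x.2} := rfl
        rw [show {x : Σ n, F n | g η x.1 = x.2} = {x : Σ n, F n | g η' x.1 = x.2} from h] at hmem
        exact hn' (Eq.symm hmem)
    _ ≤ 2 ^ ℵ₀ := by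
        rw [Cardinal.mk_set]
        exact Cardinal.power_le_power_left two_ne_zero Cardinal.mk_le_aleph0

/-! ### Homomorphisms into a direct sum -/

/-- For `η : ℕ → Σ n, ι n` let `φ η n` be the coordinate of index `g η n` of `r n`, where the `g η`
are eventually different. For a fixed `x`, at most `2 ^ ℵ₀` of the `η` have `φ η n x ≠ 0` for
infinitely many `n`; hence for most `η` the sum of the `φ η n` has its values in the direct sum. -/
theorem mk_sigma_power_aleph0_le_mk_addMonoidHom_directSum {G : Type u} [AddCommGroup G]
    {A : Type} {H : A → Type u} [∀ a, AddCommGroup (H a)] {P : ℕ → A}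
    (hP : Function.Injective P) {ι : ℕ → Type u} (hι : ∀ n, ℵ₀ ≤ #(ι n))
    (hmono : Monotone fun n ↦ #(ι n)) {R : ℕ → Type} [∀ n, Ring (R n)] [∀ n, Nontrivial (R n)]
    {r : ∀ n, G →+ (ι n →₀ R n)} (hr : ∀ n, Function.Surjective (r n))
    {j : ∀ n, R n →+ H (P n)} (hj : ∀ n, Function.Injective (j n))
    (hG : 2 ^ ℵ₀ ≤ #G) (hG' : #G < #(Σ n, ι n) ^ ℵ₀) :
    #(Σ n, ι n) ^ ℵ₀ ≤ #(G →+ ⨁ a, H a) := by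
  classical
  obtain ⟨g, hg⟩ := exists_eventually_ne_of_sigma hι hmono
  have hM : #(ℕ → Σ n, ι n) = #(Σ n, ι n) ^ ℵ₀ := by simp
  have hGinf : ℵ₀ ≤ #G := (Cardinal.cantor ℵ₀).le.trans hG
  let bad : Set (ℕ → Σ n, ι n) :=
    ⋃ x : G, {η | ∃ᶠ n in Filter.atTop, g η n ∈ (r n x).support}
  have hbad : #bad < #(ℕ → Σ n, ι n) := by
    rw [hM]
    refine lt_of_le_of_lt ?_ hG'
    refine (Cardinal.mk_iUnion_le _).trans ?_
    refine Cardinal.mul_le_of_le hGinf le_rfl ?_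
    exact ciSup_le' fun x ↦ (mk_frequently_mem_le hg _).trans hG
  have : Infinite (ℕ → Σ n, ι n) := by
    rw [Cardinal.infinite_iff, hM]
    exact hGinf.trans hG'.le
  have hgood : #(badᶜ : Set _) = #(Σ n, ι n) ^ ℵ₀ := by
    rw [Cardinal.mk_compl_of_infinite bad hbad, hM]
  let φ : (ℕ → Σ n, ι n) → ∀ n, G →+ ⨁ a, H a := fun η n ↦
    (DirectSum.of H (P n)).comp ((j n).comp ((Finsupp.applyAddHom (g η n)).comp (r n)))
  have hφ : ∀ η n x, φ η n x = DirectSum.of H (P n) (j n (r n x (g η n))) := fun _ _ _ ↦ rfl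
  have hfin : ∀ η : (badᶜ : Set _), ∀ x, (Function.support fun n ↦ φ η n x).Finite := by
    intro η x
    have hη : ¬ ∃ᶠ n in Filter.atTop, g η n ∈ (r n x).support :=
      fun h ↦ η.2 (Set.mem_iUnion.2 ⟨x, h⟩)
    rw [Nat.frequently_atTop_iff_infinite, Set.not_infinite] at hη
    refine hη.subset fun n hn ↦ ?_
    rw [Set.mem_ofPred_eq, Finsupp.mem_support_iff]
    intro h0
    exact hn (by simp only [hφ, h0, map_zero])
  let Ψ : (badᶜ : Set _) → (G →+ ⨁ a, H a) := fun η ↦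
    AddMonoidHom.mk' (fun x ↦ ∑ᶠ n, φ η n x) fun x y ↦ by
      simp only [map_add]
      exact finsum_add_distrib (hfin η x) (hfin η y)
  have hΨ : ∀ η x n, Ψ η x (P n) = j n (r n x (g η n)) := by
    intro η x n
    change (DFinsupp.evalAddMonoidHom (P n) : (⨁ a, H a) →+ H (P n)) (∑ᶠ m, φ η m x) = _
    rw [AddMonoidHom.map_finsum _ (hfin η x), finsum_eq_single _ n]
    · exact DirectSum.of_eq_same (β := H) (P n) _
    · intro m hm
      exact DirectSum.of_eq_of_ne (β := H) (P m) (P n) _ fun h ↦ hm (hP h).symm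
  rw [← hgood]
  refine Cardinal.mk_le_of_injective (f := Ψ) ?_
  intro η η' h
  refine Subtype.ext ?_
  by_contra hne
  obtain ⟨n, hn⟩ := (hg hne).exists
  obtain ⟨x, hx⟩ := hr n (Finsupp.single (g η n) 1)
  have h1 := hΨ η x n
  rw [h, hΨ, hx, Finsupp.single_eq_same, Finsupp.single_eq_of_ne' hn] at h1
  exact one_ne_zero (hj n h1).symm

/-- A supremum of countably many cardinals that is not attained is the limit of a strictly
increasing sequence of them. -/
theorem exists_strictMono_of_forall_lt_iSup {A : Type*} [Countable A] [Small.{u} A]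
    {f : A → Cardinal.{u}} {c : Cardinal.{u}} (hc : c < ⨆ a, f a) (hlt : ∀ a, f a < ⨆ a, f a) :
    ∃ P : ℕ → A, StrictMono (f ∘ P) ∧ (∀ n, c ≤ f (P n)) ∧ ∀ a, ∃ n, f a ≤ f (P n) := by
  have hbdd : BddAbove (Set.range f) := Cardinal.bddAbove_of_small
  have hex : ∀ d : Cardinal.{u}, d < ⨆ a, f a → ∃ a, d < f a := fun d hd ↦
    (lt_ciSup_iff' hbdd).1 hd
  obtain ⟨a₀, ha₀⟩ := hex c hc
  have : Nonempty A := ⟨a₀⟩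
  obtain ⟨e, he⟩ := exists_surjective_nat A
  choose up hup using fun a b ↦ hex (max (f a) (f b)) (max_lt (hlt a) (hlt b))
  let P : ℕ → A := fun n ↦ Nat.rec a₀ (fun n a ↦ up a (e n)) n
  have hP : ∀ n, max (f (P n)) (f (e n)) < f (P (n + 1)) := fun n ↦ hup _ _
  have hmono : StrictMono (f ∘ P) :=
    strictMono_nat_of_lt_succ fun n ↦ (le_max_left _ _).trans_lt (hP n)
  refine ⟨P, hmono, fun n ↦ ha₀.le.trans (hmono.monotone n.zero_le), fun a ↦ ?_⟩
  obtain ⟨n, rfl⟩ := he a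
  exact ⟨n + 1, ((le_max_right _ _).trans_lt (hP n)).le⟩

/-! ### Counting homomorphisms -/

theorem mainTheorem4 (lam : Cardinal.{u})
    (h_lam : (2 : Cardinal.{u}) ^ ℵ₀ < lam) (h_lam' : lam < lam ^ ℵ₀)
    (G : Type u) [AddCommGroup G] (hG_card : #G = lam) (hG_red : IsReducedAbelian G)
    (hG_quot : #(G ⧸ AddCommGroup.torsion G) ^ ℵ₀ = lam ^ ℵ₀)
    (A : Set Nat.Primes)
    (K : A → AddSubgroup G) (Kn : A → ℕ → AddSubgroup G)
    (hK_indep : ∀ p : A, iSupIndep (Kn p)) (hK_sum : ∀ p : A, K p = ⨆ n, Kn p n)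
    (hK_pure : ∀ p : A, IsPureSubgroup (K p))
    (hKn_ne : ∀ (p : A) (n : ℕ), Kn p n ≠ ⊥)
    (hKn_fin : ∀ (p : A) (n : ℕ), Finite (Kn p n))
    (hKn_pgroup : ∀ (p : A) (n : ℕ), IsAbelianPGroup (Kn p n) (p : Nat.Primes))
    (h_div : ∀ p : Nat.Primes, p ∉ A →
      IsNatDivisible (G ⧸ AddCommGroup.primaryComponent G (p : ℕ)) (p : ℕ))
    (h_tor : ∀ p : Nat.Primes, p ∉ A →
      #(AddCommGroup.primaryComponent G (p : ℕ)) ≤ (2 : Cardinal.{u}) ^ ℵ₀) :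
    lam ^ ℵ₀ ≤ #(G →+ ⨁ p : A, K p) := by
  classical
  have hprime : ∀ p : A, Fact (Nat.Prime (p : Nat.Primes)) := fun p ↦ ⟨p.1.2⟩
  have hj : ∀ p : A, ∃ j : ZMod (p : Nat.Primes) →+ K p, Function.Injective j := by
    intro p
    have : Nontrivial (Kn p 0) := (AddSubgroup.nontrivial_iff_ne_bot _).2 (hKn_ne p 0)
    obtain ⟨j, hj⟩ := exists_zmod_injective (hKn_pgroup p 0)
    have hle : Kn p 0 ≤ K p := hK_sum p ▸ le_iSup (Kn p) 0
    exact ⟨(AddSubgroup.inclusion hle).comp j, (AddSubgroup.inclusion_injective hle).comp hj⟩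
  choose j hj using hj
  let f : A → Cardinal.{u} := fun p ↦ #(ModIndex G (p : Nat.Primes))
  have hbdd : BddAbove (Set.range f) := Cardinal.bddAbove_of_small
  set μ : Cardinal.{u} := ⨆ p, f p with hμ
  have hcont : ℵ₀ ≤ (2 : Cardinal.{u}) ^ ℵ₀ := (Cardinal.cantor ℵ₀).le
  have hcontpow : ((2 : Cardinal.{u}) ^ ℵ₀) ^ ℵ₀ = 2 ^ ℵ₀ := by
    rw [← Cardinal.power_mul, Cardinal.aleph0_mul_aleph0]
  have hlam_le : lam ≤ (max (2 ^ ℵ₀) μ) ^ ℵ₀ := by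
    rw [← hG_card]
    refine hG_red.mk_le_power_aleph0 fun p hp ↦ ?_
    by_cases hpA : (⟨p, hp⟩ : Nat.Primes) ∈ A
    · have : Fact p.Prime := ⟨hp⟩
      exact (mk_modN_le_max G p).trans
        (max_le_max hcont (le_ciSup hbdd (⟨⟨p, hp⟩, hpA⟩ : A)))
    · exact (mk_modN_le_of_isNatDivisible_quotient (h_div ⟨p, hp⟩ hpA)).trans
        ((h_tor ⟨p, hp⟩ hpA).trans (le_max_left _ _))
  have hμ_gt : 2 ^ ℵ₀ < μ := by
    by_contra! hle
    rw [max_eq_left hle, hcontpow] at hlam_le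
    exact hlam_le.not_gt h_lam
  rw [max_eq_right hμ_gt.le] at hlam_le
  have hpow : lam ^ ℵ₀ ≤ μ ^ ℵ₀ := by
    calc lam ^ ℵ₀ ≤ (μ ^ ℵ₀) ^ ℵ₀ := Cardinal.power_le_power_right hlam_le
      _ = μ ^ ℵ₀ := by rw [← Cardinal.power_mul, Cardinal.aleph0_mul_aleph0]
  by_cases hatt : ∃ p, μ ≤ f p
  · obtain ⟨p, hp⟩ := hatt
    have hinf : ℵ₀ ≤ f p := hcont.trans (hμ_gt.le.trans hp)
    have hof : Function.Injective (DirectSum.of (fun p : A ↦ K p) p) :=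
      DirectSum.of_injective p
    calc lam ^ ℵ₀ ≤ μ ^ ℵ₀ := hpow
      _ ≤ (2 ^ f p) ^ ℵ₀ :=
        Cardinal.power_le_power_right (hp.trans (Cardinal.cantor _).le)
      _ = 2 ^ f p := by rw [← Cardinal.power_mul, Cardinal.mul_aleph0_eq hinf]
      _ ≤ #(G →+ ⨁ p : A, K p) :=
        two_power_le_mk_addMonoidHom G (p : Nat.Primes)
          (j := (DirectSum.of (fun p : A ↦ K p) p).comp (j p)) (hof.comp (hj p))
  · push Not at hatt
    obtain ⟨P, hP, hcP, hcof⟩ := exists_strictMono_of_forall_lt_iSup (hcont.trans_lt hμ_gt) hatt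
    have hμ_le : μ ≤ #(Σ n, ModIndex G (P n : Nat.Primes)) := by
      refine ciSup_le' fun a ↦ ?_
      obtain ⟨n, hn⟩ := hcof a
      exact hn.trans (Cardinal.mk_le_of_injective
        (sigma_mk_injective (β := fun n ↦ ModIndex G (P n : Nat.Primes)) (i := n)))
    have hpow' : lam ^ ℵ₀ ≤ #(Σ n, ModIndex G (P n : Nat.Primes)) ^ ℵ₀ :=
      hpow.trans (Cardinal.power_le_power_right hμ_le)
    refine hpow'.trans ?_
    have := mk_sigma_power_aleph0_le_mk_addMonoidHom_directSum (G := G)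
      (H := fun p : A ↦ K p) (P := P) (Function.Injective.of_comp hP.injective) hcP hP.monotone
      (r := fun n ↦ modCoord G (P n : Nat.Primes)) (fun n ↦ modCoord_surjective G _)
      (fun n ↦ hj (P n)) (hG_card ▸ h_lam.le) (hG_card ▸ h_lam'.trans_le hpow')
    exact this
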